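/- Let $X$ be a standard Borel space with $\sigma$-algebra $\mathcal B$, let $\mu$ be a Borel probability measure on $X$, and let $W:X\times X\to[0,1]$ be a $(\mathcal B\times\mathcal B)$-measurable map (an integral kernel). A kernel is called a graphon if $W(x,y)=W(y,x)$ for almost every $(x,y)$; kernels that agree almost everywhere are identified. Put $T_Wf(x)=\int_X W(x,y)f(y)\,d\mu(y)$ for $f\in L^2(X,\mu)$. **The algebra $\mathcal C(W)$.** A sub-$\sigma$-algebra $\mathcal C\subseteq\mathcal B$ is relatively complete if $Z\in\mathcal C$ whenever $Z\in\mathcal B$ and $\mu(Z\triangle Z_0)=0$ for some $Z_0\in\mathcal C$; $\langle\mathcal X\rangle$ denotes the smallest relatively complete sub-$\sigma$-algebra containing $\mathcal X\subseteq\mathcal B$. Let $\mathcal C_0=\langle\{\emptyset,X\}\rangle$, let $\mathcal C_{n+1}$ be the intersection of all relatively complete $\mathcal D$ with $T_W(L^2(X,\mathcal C_n,\mu))\subseteq L^2(X,\mathcal D,\mu)$, and let $\mathcal C(W)=\langle\bigcup_n\mathcal C_n\rangle$. For relatively complete $\mathcal C$ put $W_{\mathcal C}=\mathbb E(W\mid\mathcal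 B\times\mathcal C)$. **Quotients.** A quotient of $X$ by $\mathcal C$ is a standard Borel space $X/\mathcal C$ with a measurable map $q:X\to X/\mathcal C$ such that, with $\mu/\mathcal C=q_*\mu$, the isometry $f\mapsto f\circ q$ maps $L^2(X/\mathcal C,\mu/\mathcal C)$ onto $L^2(X,\mathcal C,\mu)$. Let $W/\mathcal C=S(W_{\mathcal C})$, where $S$ is the adjoint of the isometry $F\mapsto F\circ(q\times q)$ from $L^2((X/\mathcal C)^2,(\mu/\mathcal C)^2)$ to $L^2(X^2,\mu^2)$. Kernels $K$ on $(Y,\lambda)$ and $L$ on $(Z,\rho)$ are isomorphic if there is a measure preserving almost bijection $j:Y\to Z$ (a measure preserving map with a measure preserving inverse modulo null sets) such that $K(x,y)=L(j(x),j(y))$ for $(\lambda\times\lambda)$-almost every $(x,y)$. **Iterated degree measures.** For a measurable space $K$ let $\mathscr M_{\le1}(K)$ be the set of measures on $K$ of total mass at most $1$, with the $\sigma$-algebra generated by the maps $m\mapsto m(A)$, $A$ measurable (for compact metric $K$ this is the Borel $\sigma$-algebra of the weak* topology). Let $P^0=\{\star\}$, $\mathbb M_n=\prod_{i\le n}P^i$,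 $P^{n+1}=\mathscr M_{\le1}(\mathbb M_n)$ and $\mathbb M=\prod_{n\in\mathbb N}P^n$, with canonical projections $p_{n,k}:\mathbb M_k\to\mathbb M_n$ for $n\le k\le\infty$, where $\mathbb M_\infty=\mathbb M$. Let $\mathbb P$ be the set of $\alpha\in\mathbb M$ with $\alpha(n+1)=(p_{n,n+1})_*\alpha(n+2)$ for all $n$; for $\alpha\in\mathbb P$ let $\mu_\alpha$ be the unique measure on $\mathbb M$ with $(p_{n,\infty})_*\mu_\alpha=\alpha(n+1)$ for all $n$. A probability measure $\nu$ on $\mathbb M$ is a DIDM (distribution on iterated degree measures) if $\nu(\mathbb P)=1$ and, for $\nu$-almost every $\alpha$, $\mu_\alpha$ is absolutely continuous with respect to $\nu$ with $0\le d\mu_\alpha/d\nu\le1$ $\nu$-almost everywhere. For a DIDM $\nu$, let $\mathbf U[\nu]$ be the Radon–Nikodym derivative with respect to $\nu\times\nu$ of the measure $\Phi(A)=\int_{\mathbb M}\mu_\alpha(\{\beta:(\alpha,\beta)\in A\})\,d\nu(\alpha)$; thus $\mathbf U[\nu](\alpha,-)=d\mu_\alpha/d\nu$ for $\nu$-almost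 every $\alpha$. **From $W$ to a DIDM.** Let $i_{W,0}:X\to\mathbb M_0$ be the constant map, and define $i_{W,n+1}:X\to\mathbb M_{n+1}$ by $i_{W,n+1}(x)(j)=i_{W,n}(x)(j)$ for $j\le n$ and $i_{W,n+1}(x)(n+1)(A)=\int_{i_{W,n}^{-1}(A)}W(x,y)\,d\mu(y)$ for measurable $A\subseteq\mathbb M_n$. Let $i_W:X\to\mathbb M$ be given by $i_W(x)(n)=i_{W,n}(x)(n)$, and let $\nu_W=(i_W)_*\mu$. **Theorem.** For every integral kernel $W$ on $X$, $\nu_W$ is a DIDM (so that $\mathbf U[\nu_W]$ is defined) and $$W_{\mathcal C(W)}(x,y)=\mathbf U[\nu_W](i_W(x),i_W(y))\qquad\text{for }(\mu\times\mu)\text{-almost every }(x,y)\in X\times X.$$ If moreover $W$ is a graphon, then a quotient $X/\mathcal C(W)$ exists; for every such quotient, the kernel $W/\mathcal C(W)$ on $(X/\mathcal C(W),\mu/\mathcal C(W))$ is isomorphic to the kernel $\mathbf U[\nu_W]$ on $(\mathbb M,\nu_W)$; and $\mathbf U[\nu_W]$ is a graphon on $(\mathbb M,\nu_W)$, that is,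 it is measurable, $[0,1]$-valued almost everywhere and symmetric almost everywhere. -/

import Mathlib

open MeasureTheory Set
open scoped ENNReal

universe u v

noncomputable section

namespace IteratedDegree

/-! ### Integral kernels and graphons -/

/-- An integral kernel on `X`: a measurable map `X × X → [0,1]`. -/
structure IntegralKernel (X : Type u) [MeasurableSpace X] where
  toFun : X × X → ℝ
  measurable_toFun : Measurable toFun
  mem_Icc : ∀ p, toFun p ∈ Icc (0 : ℝ) 1

instance {X : Type u} [MeasurableSpace X] :
    CoeFun (IntegralKernel X) (fun _ => X × X → ℝ) :=
  ⟨IntegralKernel.toFun⟩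

/-- A graphon on the probability space `(X, μ)`. Kernels are identified when they agree
`μ × μ`-almost everywhere, so the conditions are imposed almost everywhere. -/
structure IsGraphon {X : Type u} [MeasurableSpace X] (μ : Measure X) (K : X × X → ℝ) : Prop where
  measurable : Measurable K
  mem_Icc : ∀ᵐ p ∂(μ.prod μ), K p ∈ Icc (0 : ℝ) 1
  symm : ∀ᵐ p ∂(μ.prod μ), K (p.1, p.2) = K (p.2, p.1)

/-- Two kernels on `(X, μ)` and `(Y, ν)` are isomorphic if one is the pull-back of the other along
a measure preserving almost bijection `j`, that is, a measure preserving map which has a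
measure preserving inverse `k` modulo null sets. -/
def Isomorphic {X : Type u} {Y : Type v} [MeasurableSpace X] [MeasurableSpace Y]
    (μ : Measure X) (K : X × X → ℝ) (ν : Measure Y) (L : Y × Y → ℝ) : Prop :=
  ∃ (j : X → Y) (k : Y → X), MeasurePreserving j μ ν ∧ MeasurePreserving k ν μ ∧
    (∀ᵐ x ∂μ, k (j x) = x) ∧ (∀ᵐ y ∂ν, j (k y) = y) ∧
    ∀ᵐ p ∂(μ.prod μ), K p = L (j p.1, j p.2)

/-- The integral operator `T_W`. -/
def intOp {X : Type u} [MeasurableSpace X] (μ : Measure X) (W : X × X → ℝ) (f : X → ℝ) : X → ℝ :=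
  fun x => ∫ y, W (x, y) * f y ∂μ

/-! ### Relatively complete sub-σ-algebras and the algebra `C(W)` -/

/-- `C` is a `μ`-relatively complete sub-σ-algebra of the ambient σ-algebra `mX`. -/
def RelComplete {X : Type u} (C : MeasurableSpace X) {mX : MeasurableSpace X}
    (μ : Measure X) : Prop :=
  C ≤ mX ∧ ∀ Z Z₀ : Set X, MeasurableSet[mX] Z → MeasurableSet[C] Z₀ →
    μ (symmDiff Z Z₀) = 0 → MeasurableSet[C] Z

/-- The smallest relatively complete sub-σ-algebra containing the family `S` of measurable sets. -/
def relGenerated {X : Type u} {mX : MeasurableSpace X} (μ : Measure X) (S : Set (Set X)) :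
    MeasurableSpace X :=
  sInf {D | RelComplete D μ ∧ ∀ A ∈ S, MeasurableSet[D] A}

/-- `f` represents an element of `L²(X, C, μ)`. -/
def MemL2 {X : Type u} (C : MeasurableSpace X) {mX : MeasurableSpace X} (μ : Measure X)
    (f : X → ℝ) : Prop :=
  MemLp f 2 μ ∧ AEStronglyMeasurable[C] f μ

/-- `(D, E)` is a `W`-invariant pair: `T_W` maps `L²(X, D, μ)` into `L²(X, E, μ)`. -/
def InvariantPair {X : Type u} (D E : MeasurableSpace X) {mX : MeasurableSpace X}
    (μ : Measure X) (W : X × X → ℝ) : Prop :=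
  ∀ f : X → ℝ, MemL2 D μ f → MemL2 E μ (intOp μ W f)

/-- The algebra `m(C)`, the intersection of all relatively complete `D` such that `(C, D)` is a
`W`-invariant pair. -/
def nextAlgebra {X : Type u} (C : MeasurableSpace X) {mX : MeasurableSpace X}
    (μ : Measure X) (W : X × X → ℝ) : MeasurableSpace X :=
  sInf {D | RelComplete D μ ∧ InvariantPair C D μ W}

/-- The canonical sequence `C_0, C_1, ...` of sub-σ-algebras attached to `W`. -/
def canonicalSeq {X : Type u} {mX : MeasurableSpace X} (μ : Measure X) (W : X × X → ℝ) :
    ℕ → MeasurableSpace X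
  | 0 => relGenerated μ {∅, univ}
  | n + 1 => nextAlgebra (canonicalSeq μ W n) μ W

/-- The algebra `C(W)`, generated by the canonical sequence. -/
def minAlgebra {X : Type u} {mX : MeasurableSpace X} (μ : Measure X) (W : X × X → ℝ) :
    MeasurableSpace X :=
  relGenerated μ (⋃ n, {A | MeasurableSet[canonicalSeq μ W n] A})

/-- The averaged kernel `W_C = E(W | B × C)`, where `B` is the ambient σ-algebra. -/
def condKernel {X : Type u} (C : MeasurableSpace X) {mX : MeasurableSpace X}
    (μ : Measure X) (W : X × X → ℝ) : X × X → ℝ :=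
  condExp (MeasurableSpace.prod mX C) (μ.prod μ) W

/-! ### Quotients -/

/-- The isometry `f ↦ f ∘ q` from `L²(Y, q_* μ)` to `L²(X, μ)`. -/
def pullback {X : Type u} {Y : Type v} [MeasurableSpace X] [MeasurableSpace Y] {μ : Measure X}
    {ν : Measure Y} {q : X → Y} (hq : MeasurePreserving q μ ν) : Lp ℝ 2 ν →ₗᵢ[ℝ] Lp ℝ 2 μ :=
  Lp.compMeasurePreservingₗᵢ ℝ q hq

/-- The map `q : X → Y` realizes the quotient `X / C`: the space `Y` carries the push-forward
`q_* μ`, and `f ↦ f ∘ q` is an isometry of `L²(Y, q_* μ)` onto `L²(X, C, μ)`. It is used only for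
standard Borel `Y`. -/
structure IsQuotient {X : Type u} (C : MeasurableSpace X) {mX : MeasurableSpace X} {Y : Type v}
    [MeasurableSpace Y] (μ : Measure X) (q : X → Y) : Prop where
  measurable : Measurable q
  range_eq : LinearMap.range (pullback (measurable.measurePreserving μ)).toLinearMap =
    lpMeas ℝ ℝ C 2 μ

theorem memLp_condKernel {X : Type u} (C : MeasurableSpace X) [mX : MeasurableSpace X]
    (μ : Measure X) [IsProbabilityMeasure μ] (W : IntegralKernel X) :
    MemLp (condKernel C μ W) 2 (μ.prod μ) := by
  refine MemLp.condExp (by norm_num) (MemLp.of_bound W.measurable_toFun.aestronglyMeasurable 1 ?_)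
  refine Filter.Eventually.of_forall fun p => ?_
  rw [Real.norm_eq_abs, abs_of_nonneg (W.mem_Icc p).1]
  exact (W.mem_Icc p).2

/-- The quotient kernel `W / C = S (W_C)` on `Y × Y`, where `S` is the adjoint of the pull-back
along `q × q`. -/
def quotientKernel {X : Type u} (C : MeasurableSpace X) [mX : MeasurableSpace X] {Y : Type v}
    [MeasurableSpace Y] (μ : Measure X) [IsProbabilityMeasure μ] (W : IntegralKernel X)
    {q : X → Y} (hq : Measurable q) : Lp ℝ 2 ((μ.map q).prod (μ.map q)) :=
  ContinuousLinearMap.adjoint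
    (pullback ((hq.measurePreserving μ).prod (hq.measurePreserving μ))).toContinuousLinearMap
    ((memLp_condKernel C μ W).toLp (condKernel C μ W))

/-! ### The space of iterated degree measures -/

/-- Measures of total mass at most one on `K`, with the σ-algebra generated by the evaluations
`m ↦ m A`. For a compact metric space `K` it is the Borel σ-algebra of the weak* topology. -/
def SubProb (K : Type) [MeasurableSpace K] : Type := {m : Measure K // m univ ≤ 1}

instance (K : Type) [MeasurableSpace K] : MeasurableSpace (SubProb K) :=
  inferInstanceAs (MeasurableSpace {m : Measure K // m univ ≤ 1})

/-- The spaces `M_n` with their σ-algebras: `M_0` is a point and `M_{n+1} = M_n × P^{n+1}`, where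
`P^{n+1}` is the space of measures of mass at most one on `M_n`. -/
def MBundled : ℕ → (K : Type) × MeasurableSpace K
  | 0 => ⟨Unit, inferInstance⟩
  | n + 1 =>
    letI := (MBundled n).2
    ⟨(MBundled n).1 × SubProb (MBundled n).1, inferInstance⟩

/-- `M_n = P^0 × ... × P^n`. -/
def M (n : ℕ) : Type := (MBundled n).1

instance (n : ℕ) : MeasurableSpace (M n) := (MBundled n).2

/-- `P^0` is a point, `P^{n+1}` is the space of measures of mass at most one on `M_n`. -/
def P : ℕ → Type
  | 0 => Unit
  | n + 1 => SubProb (M n)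

instance instMeasurableSpaceP : (n : ℕ) → MeasurableSpace (P n)
  | 0 => inferInstanceAs (MeasurableSpace Unit)
  | n + 1 => inferInstanceAs (MeasurableSpace (SubProb (M n)))

/-- The pairing that identifies `M_n × P^{n+1}` with `M_{n+1}`. -/
def M.snoc {n : ℕ} (a : M n) (m : SubProb (M n)) : M (n + 1) := (a, m)

/-- The projection `p_{n,n+1}`. -/
def M.init {n : ℕ} (a : M (n + 1)) : M n := Prod.fst a

/-- The space of iterated degree measures, the product of all `P^n`. -/
def IDM : Type := (n : ℕ) → P n

instance : MeasurableSpace IDM := inferInstanceAs (MeasurableSpace ((n : ℕ) → P n))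

/-- The coordinate `α(n+1)`, as a measure on `M_n`. -/
def IDM.coord (α : IDM) (n : ℕ) : Measure (M n) := Subtype.val (α (n + 1) : SubProb (M n))

/-- The projection `p_{n,∞}` onto the coordinates `0, ..., n`. -/
def IDM.proj : (n : ℕ) → IDM → M n
  | 0, _ => ()
  | n + 1, α => M.snoc (IDM.proj n α) (α (n + 1))

/-- The coherent sequences of measures. -/
def coherent : Set IDM := {α | ∀ n, α.coord n = (α.coord (n + 1)).map M.init}

open Classical in
/-- The measure `μ_α` whose projections are the coordinates of `α`. It is unique, and it exists
exactly for coherent `α`; the value for other `α` is irrelevant. -/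
def limitMeasure (α : IDM) : Measure IDM :=
  if h : ∃ m : Measure IDM, ∀ n, m.map (IDM.proj n) = α.coord n then h.choose else 0

/-- Distributions on iterated degree measures. -/
structure IsDIDM (ν : Measure IDM) : Prop where
  isProbabilityMeasure : IsProbabilityMeasure ν
  coherent_eq_one : ν coherent = 1
  absolutelyContinuous : ∀ᵐ α ∂ν, limitMeasure α ≪ ν ∧
    ∀ᵐ β ∂ν, (limitMeasure α).rnDeriv ν β ≤ 1

/-- The measure `Φ(A) = ∫ μ_α(A_α) dν(α)` on pairs of iterated degree measures, where `A_α` is the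
section of `A` at `α`. -/
def pairMeasure (ν : Measure IDM) : Measure (IDM × IDM) :=
  ν.bind fun α => (limitMeasure α).map (Prod.mk α)

/-- The kernel `U[ν]` of a DIDM `ν`: the Radon-Nikodym derivative of `Φ` with respect to `ν × ν`,
so that `U[ν](α, -) = dμ_α / dν` for almost every `α`. -/
def didmKernel (ν : Measure IDM) : IDM × IDM → ℝ :=
  fun p => ((pairMeasure ν).rnDeriv (ν.prod ν) p).toReal

/-! ### From kernels to DIDMs -/

theorem map_mass_le {X : Type u} {K : Type} [MeasurableSpace X] [MeasurableSpace K]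
    (m : Measure X) (i : X → K) : m.map i univ ≤ m univ := by
  by_cases hi : AEMeasurable i m
  · rw [Measure.map_apply_of_aemeasurable hi MeasurableSet.univ, preimage_univ]
  · simp [Measure.map_of_not_aemeasurable hi]

/-- The measure `A ↦ ∫_{i⁻¹(A)} W(x, -) dμ`. -/
def weightedPush {X : Type u} [MeasurableSpace X] (μ : Measure X) [IsProbabilityMeasure μ]
    (W : IntegralKernel X) {K : Type} [MeasurableSpace K] (i : X → K) (x : X) : SubProb K :=
  ⟨(μ.withDensity fun y => ENNReal.ofReal (W (x, y))).map i, by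
    refine (map_mass_le _ i).trans ?_
    rw [withDensity_apply _ MeasurableSet.univ, Measure.restrict_univ]
    refine (lintegral_mono (g := fun _ => 1) fun y => ?_).trans (by simp)
    exact ENNReal.ofReal_le_one.2 (W.mem_Icc (x, y)).2⟩

theorem measurable_weightedPush {X : Type u} [MeasurableSpace X] (μ : Measure X)
    [IsProbabilityMeasure μ] (W : IntegralKernel X) {K : Type} [MeasurableSpace K] {i : X → K}
    (hi : Measurable i) : Measurable (weightedPush μ W i) := by
  refine Measurable.subtype_mk (Measure.measurable_of_measurable_coe _ fun A hA => ?_)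
  have h : ∀ x, (μ.withDensity fun y => ENNReal.ofReal (W (x, y))).map i A =
      ∫⁻ y in i ⁻¹' A, ENNReal.ofReal (W (x, y)) ∂μ := fun x => by
    rw [Measure.map_apply hi hA, withDensity_apply _ (hi hA)]
  simp_rw [h]
  exact Measurable.lintegral_prod_right' (f := fun p => ENNReal.ofReal (W p))
    W.measurable_toFun.ennreal_ofReal

/-- The maps `i_{W,n} : X → M_n`. -/
def idmStage {X : Type u} [MeasurableSpace X] (μ : Measure X) [IsProbabilityMeasure μ]
    (W : IntegralKernel X) : (n : ℕ) → X → M n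
  | 0 => fun _ => ()
  | n + 1 => fun x => M.snoc (idmStage μ W n x) (weightedPush μ W (idmStage μ W n) x)

/-- The map `i_W : X → IDM`, whose coordinate `n + 1` is the last coordinate of `i_{W,n+1}`. -/
def idm {X : Type u} [MeasurableSpace X] (μ : Measure X) [IsProbabilityMeasure μ]
    (W : IntegralKernel X) (x : X) : IDM
  | 0 => ()
  | n + 1 => weightedPush μ W (idmStage μ W n) x

theorem measurable_idmStage {X : Type u} [MeasurableSpace X] (μ : Measure X)
    [IsProbabilityMeasure μ] (W : IntegralKernel X) (n : ℕ) : Measurable (idmStage μ W n) := by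
  induction n with
  | zero => exact measurable_const
  | succ n ih => exact Measurable.prodMk ih (measurable_weightedPush μ W ih)

theorem measurable_idm {X : Type u} [MeasurableSpace X] (μ : Measure X)
    [IsProbabilityMeasure μ] (W : IntegralKernel X) : Measurable (idm μ W) := by
  refine measurable_pi_lambda _ fun n => ?_
  cases n with
  | zero => exact measurable_const
  | succ n => exact measurable_weightedPush μ W (measurable_idmStage μ W n)

/-- The push-forward `ν_W` of `μ` along `i_W`. -/
def kernelDIDM {X : Type u} [MeasurableSpace X] (μ : Measure X) [IsProbabilityMeasure μ]
    (W : IntegralKernel X) : Measure IDM :=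
  μ.map (idm μ W)

end IteratedDegree

end

noncomputable section

namespace IteratedDegree

/-! ### The measurable structure of the space of iterated degree measures -/

/-! Write ν for ν_W. Push W·(μ×μ) forward along i_W × i_W (`jointLaw`). Since W ≤ 1, the image lies
below ν×ν, so it has a density D with values in [0,1]. By Fubini its mass on B × p_{n,∞}⁻¹(A) is ∫_B
α(n+1)(A) dν(α); hence for almost every α the measure D(α,-)ν has the coordinates of α as its
projections (`IsJointDensity.map_proj`). Finite measures on `IDM` are determined by their
projections, which gives two things. First, μ_α = D(α,-)ν, so ν is a DIDM and U[ν] = D almost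
everywhere. Second, the i_W-image of W(x,-)μ also projects to the coordinates of i_W(x), so it
equals D(i_W(x),-)ν for almost every x (`IsJointDensity.map_idm`).

On the operator side, C(W) is the relative completion of the σ-algebra generated by i_W
(`minAlgebra_eq`): the values of coordinate n+1 on sets are T_W of indicators, and conversely T_W of
a function of i_{W,n} is an integral against that coordinate. So `IsJointDensity.map_idm` says that
W and D∘(i_W×i_W) have equal integrals over B × C for C in C(W), which identifies the conditional
expectation.

A quotient map q generates C(W) modulo null sets, and so does i_W. Each therefore factors through
the other almost everywhere, and these factorizations are the isomorphism. -/

theorem countablyGenerated_iSup {α : Type*} {m : ℕ → MeasurableSpace α}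
    (h : ∀ n, @MeasurableSpace.CountablyGenerated α (m n)) :
    @MeasurableSpace.CountablyGenerated α (⨆ n, m n) := by
  choose b hb hm using fun n => (h n).isCountablyGenerated
  refine @MeasurableSpace.CountablyGenerated.mk α (_) ⟨⋃ n, b n, countable_iUnion hb, ?_⟩
  rw [← MeasurableSpace.iSup_generateFrom]
  exact iSup_congr hm

/-- A countably generated σ-algebra is generated by a countable π-system. -/
theorem exists_countable_piSystem (K : Type*) [mK : MeasurableSpace K]
    [MeasurableSpace.CountablyGenerated K] :
    ∃ S : Set (Set K), S.Countable ∧ IsPiSystem S ∧ univ ∈ S ∧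
      mK = MeasurableSpace.generateFrom S :=
  ⟨generateSetAlgebra (MeasurableSpace.countableGeneratingSet K),
    countable_generateSetAlgebra MeasurableSpace.countable_countableGeneratingSet,
    fun _ hs _ ht _ => isSetAlgebra_generateSetAlgebra.inter_mem hs ht,
    isSetAlgebra_generateSetAlgebra.univ_mem, by
      rw [generateFrom_generateSetAlgebra_eq,
        MeasurableSpace.generateFrom_countableGeneratingSet]⟩

theorem measurable_subProb_val (K : Type) [MeasurableSpace K] :
    Measurable (Subtype.val : SubProb K → Measure K) :=
  measurable_subtype_coe

theorem isFiniteMeasure_subProb {K : Type} [MeasurableSpace K] (m : SubProb K) :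
    IsFiniteMeasure m.1 :=
  ⟨m.2.trans_lt ENNReal.one_lt_top⟩

/-- Evaluations on a countable generating π-system that contains the whole space already generate
all evaluations, by a Dynkin argument for finite measures. -/
theorem countablyGenerated_subProb (K : Type) [mK : MeasurableSpace K]
    [MeasurableSpace.CountablyGenerated K] : MeasurableSpace.CountablyGenerated (SubProb K) := by
  obtain ⟨S, hc, hpi, huniv, hgen⟩ := exists_countable_piSystem K
  obtain ⟨A, rfl⟩ := hc.exists_eq_range ⟨univ, huniv⟩
  have hA : ∀ n, MeasurableSet (A n) := fun n => by
    rw [hgen]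
    exact MeasurableSpace.measurableSet_generateFrom (mem_range_self n)
  let ev : ℕ → SubProb K → ℝ≥0∞ := fun n m => m.1 (A n)
  have hev : ∀ n, Measurable (ev n) := fun n =>
    (Measure.measurable_coe (hA n)).comp (measurable_subProb_val K)
  have key : instMeasurableSpaceSubProb K =
      ⨆ n, MeasurableSpace.comap (ev n) inferInstance := by
    refine le_antisymm ?_ (iSup_le fun n => (hev n).comap_le)
    have hfin : ∀ m : SubProb K, IsFiniteMeasure m.1 := isFiniteMeasure_subProb
    have hn : ∀ n, Measurable[⨆ n, MeasurableSpace.comap (ev n) inferInstance] (ev n) := fun n =>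
      (comap_measurable (ev n)).mono (le_iSup (fun n => MeasurableSpace.comap (ev n) _) n) le_rfl
    obtain ⟨n₀, hn₀⟩ := huniv
    have hval : Measurable[⨆ n, MeasurableSpace.comap (ev n) inferInstance]
        (Subtype.val : SubProb K → Measure K) := by
      refine @Measurable.measure_of_isPiSystem _ _ (_) mK _ hfin _ hgen hpi ?_ ?_
      · rintro _ ⟨n, rfl⟩
        exact hn n
      · have := hn n₀
        simp only [ev, hn₀] at this
        exact this
    exact hval.comap_le
  rw [key]
  exact countablyGenerated_iSup fun n => MeasurableSpace.CountablyGenerated.comap _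

instance (K : Type) [MeasurableSpace K] : MeasurableSpace.SeparatesPoints (SubProb K) where
  separates x y h := by
    refine Subtype.ext (Measure.ext fun s hs => ?_)
    have hm : Measurable fun m : SubProb K => m.1 s :=
      (Measure.measurable_coe hs).comp (measurable_subProb_val K)
    exact (h _ (hm (measurableSet_singleton (x.1 s))) rfl).symm

instance (n : ℕ) : MeasurableSpace.CountablyGenerated (M n) := by
  induction n with
  | zero => exact inferInstanceAs (MeasurableSpace.CountablyGenerated Unit)
  | succ n ih =>
    have := countablyGenerated_subProb (M n)
    exact inferInstanceAs (MeasurableSpace.CountablyGenerated (M n × SubProb (M n)))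

instance (n : ℕ) : MeasurableSpace.CountablyGenerated (P n) :=
  match n with
  | 0 => inferInstanceAs (MeasurableSpace.CountablyGenerated Unit)
  | n + 1 => countablyGenerated_subProb (M n)

instance (n : ℕ) : MeasurableSpace.SeparatesPoints (P n) :=
  match n with
  | 0 => inferInstanceAs (MeasurableSpace.SeparatesPoints Unit)
  | n + 1 => inferInstanceAs (MeasurableSpace.SeparatesPoints (SubProb (M n)))

theorem measurable_idm_apply (n : ℕ) : Measurable fun α : IDM => α n :=
  measurable_pi_apply (X := P) n

instance : MeasurableSpace.CountablyGenerated IDM :=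
  countablyGenerated_iSup fun _ => MeasurableSpace.CountablyGenerated.comap _

instance : MeasurableSpace.SeparatesPoints IDM where
  separates x y h := by
    funext n
    refine MeasurableSpace.SeparatesPoints.separates _ _ fun s hs hx => ?_
    exact h _ (measurable_idm_apply n hs) hx

theorem M.measurable_init {n : ℕ} : Measurable (M.init : M (n + 1) → M n) :=
  measurable_fst (α := M n) (β := SubProb (M n))

theorem IDM.measurable_proj (n : ℕ) : Measurable (IDM.proj n) := by
  induction n with
  | zero => exact measurable_const
  | succ n ih => exact Measurable.prodMk ih (measurable_idm_apply (n + 1))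

theorem IDM.init_comp_proj (n : ℕ) : M.init ∘ IDM.proj (n + 1) = IDM.proj n := rfl

theorem IDM.measurable_coord (n : ℕ) : Measurable fun α : IDM => α.coord n :=
  (measurable_subProb_val (M n)).comp (measurable_idm_apply (n + 1))

theorem IDM.coord_univ_le (α : IDM) (n : ℕ) : α.coord n univ ≤ 1 :=
  Subtype.prop (α (n + 1) : SubProb (M n))

instance (α : IDM) (n : ℕ) : IsFiniteMeasure (α.coord n) :=
  ⟨(α.coord_univ_le n).trans_lt ENNReal.one_lt_top⟩

theorem IDM.comap_proj_mono :
    Monotone fun n => MeasurableSpace.comap (IDM.proj n) inferInstance :=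
  monotone_nat_of_le_succ fun n => by
    rw [← IDM.init_comp_proj, ← MeasurableSpace.comap_comp]
    exact MeasurableSpace.comap_mono M.measurable_init.comap_le

theorem IDM.iSup_comap_proj :
    ⨆ n, MeasurableSpace.comap (IDM.proj n) inferInstance =
      (inferInstance : MeasurableSpace IDM) := by
  refine le_antisymm (iSup_le fun n => (IDM.measurable_proj n).comap_le) (iSup_le fun n => ?_)
  cases n with
  | zero =>
    have : Measurable[⊥] fun α : IDM => α 0 := by
      have : (fun α : IDM => α 0) = fun _ => () := rfl
      rw [this]
      exact measurable_const
    exact this.comap_le.trans bot_le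
  | succ n =>
    refine le_trans ?_ (le_iSup (fun n => MeasurableSpace.comap (IDM.proj n) _) (n + 1))
    have : Measurable[MeasurableSpace.comap (IDM.proj (n + 1)) inferInstance]
        fun α : IDM => (α (n + 1) : SubProb (M n)) :=
      (measurable_snd (α := M n) (β := SubProb (M n))).comp (comap_measurable (IDM.proj (n + 1)))
    exact this.comap_le

/-- A finite measure on the space of iterated degree measures is determined by its projections. -/
theorem IDM.measure_ext {m₁ m₂ : Measure IDM} [IsFiniteMeasure m₁]
    (h : ∀ n, m₁.map (IDM.proj n) = m₂.map (IDM.proj n)) : m₁ = m₂ := by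
  have hs : ∀ n (A : Set (M n)), MeasurableSet A →
      m₁ (IDM.proj n ⁻¹' A) = m₂ (IDM.proj n ⁻¹' A) := fun n A hA => by
    rw [← Measure.map_apply (IDM.measurable_proj n) hA, h,
      Measure.map_apply (IDM.measurable_proj n) hA]
  refine ext_of_generate_finite
    (⋃ n, {s | MeasurableSet[MeasurableSpace.comap (IDM.proj n) inferInstance] s}) ?_
    (isPiSystem_iUnion_of_monotone _ (fun n => ?_) fun a b hab => ?_) ?_ ?_
  · exact ((MeasurableSpace.generateFrom_iUnion_measurableSet _).trans IDM.iSup_comap_proj).symm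
  · exact @MeasurableSpace.isPiSystem_measurableSet _ (_)
  · exact IDM.comap_proj_mono hab
  · intro s hs'
    obtain ⟨n, A, hA, rfl⟩ := mem_iUnion.1 hs'
    exact hs n A hA
  -- Total masses agree because p_{0,∞} maps everything to the one-point space.
  · exact hs 0 univ MeasurableSet.univ

/-- Replaces the choice in `limitMeasure` by an explicit measure: projections determine a finite
measure, so any candidate is the chosen one. -/
theorem limitMeasure_eq {α : IDM} {m : Measure IDM} [IsFiniteMeasure m]
    (h : ∀ n, m.map (IDM.proj n) = α.coord n) : limitMeasure α = m := by
  have hex : ∃ m : Measure IDM, ∀ n, m.map (IDM.proj n) = α.coord n := ⟨m, h⟩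
  rw [limitMeasure, dif_pos hex]
  exact (IDM.measure_ext fun n => (h n).trans (hex.choose_spec n).symm).symm

/-! ### Relative completions -/

/-- The measurable sets which agree almost everywhere with a member of `m`. -/
@[reducible]
def completion {X : Type u} (m : MeasurableSpace X) {mX : MeasurableSpace X} (μ : Measure X) :
    MeasurableSpace X :=
  eventuallyMeasurableSpace m (ae μ) ⊓ mX

theorem measurableSet_completion {X : Type u} {m mX : MeasurableSpace X} {μ : Measure X}
    {s : Set X} : MeasurableSet[completion m μ] s ↔
      (∃ t, MeasurableSet[m] t ∧ s =ᵐ[μ] t) ∧ MeasurableSet[mX] s :=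
  MeasurableSpace.measurableSet_inf

theorem relComplete_completion {X : Type u} (m : MeasurableSpace X) {mX : MeasurableSpace X}
    (μ : Measure X) : RelComplete (completion m μ) μ := by
  refine ⟨inf_le_right, fun Z Z₀ hZ hZ₀ h => ?_⟩
  obtain ⟨⟨t, ht, hZt⟩, -⟩ := measurableSet_completion.1 hZ₀
  exact measurableSet_completion.2 ⟨⟨t, ht, (measure_symmDiff_eq_zero_iff.1 h).trans hZt⟩, hZ⟩

theorem le_completion {X : Type u} {m mX : MeasurableSpace X} (hm : m ≤ mX) (μ : Measure X) :
    m ≤ completion m μ :=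
  fun s hs => measurableSet_completion.2 ⟨⟨s, hs, Filter.EventuallyEq.rfl⟩, hm s hs⟩

/-- With `relComplete_completion` and `le_completion`, this makes `completion m μ` the least
relatively complete algebra above `m`. -/
theorem completion_le {X : Type u} {m D mX : MeasurableSpace X} {μ : Measure X}
    (hD : RelComplete D μ) (h : m ≤ D) : completion m μ ≤ D := by
  intro s hs
  obtain ⟨⟨t, ht, hst⟩, hs'⟩ := measurableSet_completion.1 hs
  exact hD.2 s t hs' (h t ht) (measure_symmDiff_eq_zero_iff.2 hst)

theorem completion_mono {X : Type u} {m m' mX : MeasurableSpace X} (h : m ≤ m') (μ : Measure X) :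
    completion m μ ≤ completion m' μ := by
  intro s hs
  obtain ⟨⟨t, ht, hst⟩, hs'⟩ := measurableSet_completion.1 hs
  exact measurableSet_completion.2 ⟨⟨t, h t ht, hst⟩, hs'⟩

theorem RelComplete.measurable {X : Type u} {D mX : MeasurableSpace X} {μ : Measure X}
    (hD : RelComplete D μ) {f : X → ℝ} (hf : Measurable[mX] f)
    (hf' : AEStronglyMeasurable[D] f μ) : Measurable[D] f := by
  obtain ⟨g, hg, hfg⟩ := hf'
  exact fun B hB => hD.2 _ _ (hf hB) (hg.measurable hB)
    (measure_symmDiff_eq_zero_iff.2 (hfg.preimage B))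

/-- If preimages under `f` agree almost everywhere with preimages under `i`, then `f` factors
through `i` almost everywhere. -/
theorem exists_ae_eq_comp {X Y Z : Type*} [MeasurableSpace X] [MeasurableSpace Y]
    [StandardBorelSpace Y] [Nonempty Y] [MeasurableSpace Z] {μ : Measure X} {i : X → Z} {f : X → Y}
    (h : ∀ B, MeasurableSet B → ∃ A, MeasurableSet A ∧ f ⁻¹' B =ᵐ[μ] i ⁻¹' A) :
    ∃ k : Z → Y, Measurable k ∧ f =ᵐ[μ] k ∘ i := by
  classical
  choose A hA hfA using fun n =>
    h _ (MeasurableSpace.measurableSet_natGeneratingSequence (α := Y) n)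
  have he : MeasurableEmbedding (MeasurableSpace.mapNatBool Y) :=
    (MeasurableSpace.measurable_mapNatBool Y).measurableEmbedding
      (MeasurableSpace.injective_mapNatBool Y)
  obtain ⟨g, hg, hge⟩ := he.exists_measurable_extend measurable_id fun _ => ‹Nonempty Y›
  -- The bits of `c z` record membership of `z` in the sets `A n`. Off a countable union of null
  -- sets, `c (i x)` is the code of `f x` in Cantor space, and `g` decodes it.
  let c : Z → ℕ → Bool := fun z n => decide (z ∈ A n)
  have hc : Measurable c := measurable_pi_lambda _ fun n =>
    measurable_to_bool (by
      have : (fun z => c z n) ⁻¹' {true} = A n := by ext z; simp [c]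
      rw [this]
      exact hA n)
  refine ⟨g ∘ c, hg.comp hc, ?_⟩
  have hall : ∀ᵐ x ∂μ, ∀ n, x ∈ f ⁻¹' MeasurableSpace.natGeneratingSequence Y n ↔
      x ∈ i ⁻¹' A n := ae_all_iff.2 fun n => (hfA n).mem_iff
  filter_upwards [hall] with x hx
  have : c (i x) = MeasurableSpace.mapNatBool Y (f x) := by
    funext n
    have := hx n
    simp only [mem_preimage] at this
    simp [c, MeasurableSpace.mapNatBool, this]
  simp only [Function.comp_apply, this]
  exact (congrFun hge (f x)).symm

theorem exists_ae_eq_comp_of_completion {X Z : Type*} {mX : MeasurableSpace X}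
    {mZ : MeasurableSpace Z} {μ : Measure X} {i : X → Z} {f : X → ℝ}
    (hf : AEStronglyMeasurable[completion (mZ.comap i) μ] f μ) :
    ∃ k : Z → ℝ, Measurable k ∧ f =ᵐ[μ] k ∘ i := by
  obtain ⟨g, hg, hfg⟩ := hf
  obtain ⟨k, hk, hgk⟩ := exists_ae_eq_comp (μ := μ) (i := i) (f := g) fun B hB => by
    obtain ⟨⟨_, ⟨A, hA, rfl⟩, h⟩, -⟩ := measurableSet_completion.1 (hg.measurable hB)
    exact ⟨A, hA, h⟩
  exact ⟨k, hk, hfg.trans hgk⟩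

/-- Preimages under `i × id` agree almost everywhere with preimages under `q × id` if this holds
for `i` and `q`. -/
theorem exists_preimage_prodMap_ae_eq {X Y Z V : Type*} [MeasurableSpace X] [MeasurableSpace Y]
    [MeasurableSpace Z] [MeasurableSpace V] {μ : Measure X} {ρ : Measure V} [SFinite ρ]
    {i : X → Z} {q : X → Y}
    (h : ∀ S, MeasurableSet S → ∃ T, MeasurableSet T ∧ i ⁻¹' S =ᵐ[μ] q ⁻¹' T)
    {S : Set (Z × V)} (hS : MeasurableSet S) :
    ∃ T : Set (Y × V), MeasurableSet T ∧
      Prod.map i id ⁻¹' S =ᵐ[μ.prod ρ] Prod.map q id ⁻¹' T := by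
  -- The sets that agree almost everywhere with a preimage under q × id form a σ-algebra, so only
  -- the two coordinates need to be checked.
  let E := eventuallyMeasurableSpace
    (MeasurableSpace.comap (Prod.map q (id : V → V)) inferInstance) (ae (μ.prod ρ))
  have h1 : Measurable[E] fun p : X × V => i p.1 := fun S hS => by
    obtain ⟨T, hT, hST⟩ := h S hS
    exact ⟨_, ⟨Prod.fst ⁻¹' T, measurable_fst hT, rfl⟩,
      Measure.quasiMeasurePreserving_fst.preimage_ae_eq hST⟩
  have h2 : Measurable[E] fun p : X × V => p.2 := fun S hS =>
    ⟨_, ⟨Prod.snd ⁻¹' S, measurable_snd hS, rfl⟩, Filter.EventuallyEq.rfl⟩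
  have h12 : Measurable[E] (Prod.map i (id : V → V)) := @Measurable.prodMk _ E _ _ _ _ _ _ h1 h2
  obtain ⟨_, ⟨T, hT, rfl⟩, hST⟩ := h12 hS
  exact ⟨T, hT, hST⟩

/-! ### The canonical sequence is generated by the stages of the map to iterated degree measures -/

section

variable {X : Type u} [mX : MeasurableSpace X] (μ : Measure X) (W : IntegralKernel X)

theorem IntegralKernel.measurable_section (x : X) :
    Measurable fun y => ENNReal.ofReal (W (x, y)) :=
  (W.measurable_toFun.comp measurable_prodMk_left).ennreal_ofReal

theorem intOp_congr {f g : X → ℝ} (h : f =ᵐ[μ] g) : intOp μ W f = intOp μ W g := by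
  funext x
  exact integral_congr_ae (h.mono fun y hy => by simp only [hy])

theorem abs_intOp_le {f : X → ℝ} (hf : Integrable f μ) (x : X) :
    ‖intOp μ W f x‖ ≤ ∫ y, ‖f y‖ ∂μ := by
  refine norm_integral_le_of_norm_le hf.norm (Filter.Eventually.of_forall fun y => ?_)
  rw [norm_mul, Real.norm_eq_abs, abs_of_nonneg (W.mem_Icc _).1]
  exact mul_le_of_le_one_left (norm_nonneg _) (W.mem_Icc _).2

theorem invariantPair_anti {C C' D : MeasurableSpace X} (h : C ≤ C')
    (hD : @InvariantPair X C' D mX μ W) : @InvariantPair X C D mX μ W :=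
  fun f hf => hD f ⟨hf.1, hf.2.mono h⟩

theorem canonicalSeq_zero_le {D : MeasurableSpace X} (hD : @RelComplete X D mX μ) :
    canonicalSeq μ W 0 ≤ D := by
  refine sInf_le ⟨hD, ?_⟩
  rintro A (rfl | rfl)
  · exact @MeasurableSet.empty X D
  · exact @MeasurableSet.univ X D

/-- C_0 is the least relatively complete algebra, and a larger C imposes more conditions on D, so
`nextAlgebra` is monotone. -/
theorem canonicalSeq_le_succ (n : ℕ) : canonicalSeq μ W n ≤ canonicalSeq μ W (n + 1) := by
  have h0 := fun D hD => canonicalSeq_zero_le (D := D) μ W hD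
  have h1 := fun C C' D h hD => invariantPair_anti (C := C) (C' := C') (D := D) μ W h hD
  induction n with
  | zero => exact le_sInf fun D hD => h0 D hD.1
  | succ n ih => exact le_sInf fun D hD => sInf_le ⟨hD.1, h1 _ _ D ih hD.2⟩

variable [IsProbabilityMeasure μ]

theorem weightedPush_apply {K : Type} [MeasurableSpace K] {i : X → K} (hi : Measurable i) (x : X)
    {A : Set K} (hA : MeasurableSet A) :
    (weightedPush μ W i x).1 A = ∫⁻ y in i ⁻¹' A, ENNReal.ofReal (W (x, y)) ∂μ := by
  rw [weightedPush, Measure.map_apply hi hA, withDensity_apply _ (hi hA)]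

/-- The bridge from measures to the operator, used to bound the canonical sequence from below. -/
theorem weightedPush_apply_eq_intOp {K : Type} [MeasurableSpace K] {i : X → K} (hi : Measurable i)
    (x : X) {A : Set K} (hA : MeasurableSet A) :
    (weightedPush μ W i x).1 A =
      ENNReal.ofReal (intOp μ W ((i ⁻¹' A).indicator 1) x) := by
  have hWx : Measurable fun y => W (x, y) := W.measurable_toFun.comp measurable_prodMk_left
  have : intOp μ W ((i ⁻¹' A).indicator 1) x = ∫ y in i ⁻¹' A, W (x, y) ∂μ := by
    rw [intOp, ← integral_indicator (hi hA)]
    congr 1 with y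
    by_cases hy : y ∈ i ⁻¹' A <;> simp [hy]
  rw [weightedPush_apply μ W hi x hA, this, ofReal_integral_eq_lintegral_ofReal]
  · refine Integrable.of_bound hWx.aestronglyMeasurable 1 (Filter.Eventually.of_forall fun y => ?_)
    rw [Real.norm_eq_abs, abs_of_nonneg (W.mem_Icc _).1]
    exact (W.mem_Icc _).2
  · exact Filter.Eventually.of_forall fun y => (W.mem_Icc _).1

/-- The converse bridge: T_W of a function of i depends on x only through the measure `weightedPush
μ W i x`. -/
theorem intOp_comp {K : Type} [MeasurableSpace K] {i : X → K} (hi : Measurable i) {h : K → ℝ}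
    (hh : Measurable h) (x : X) :
    intOp μ W (h ∘ i) x = ∫ a, h a ∂(weightedPush μ W i x).1 := by
  rw [weightedPush, integral_map hi.aemeasurable hh.aestronglyMeasurable,
    integral_withDensity_eq_integral_toReal_smul (W.measurable_section x)
      (Filter.Eventually.of_forall fun y => ENNReal.ofReal_lt_top)]
  refine integral_congr_ae (Filter.Eventually.of_forall fun y => ?_)
  simp [ENNReal.toReal_ofReal (W.mem_Icc (x, y)).1]

theorem memL2_indicator {C : MeasurableSpace X} (hC : C ≤ mX) {s : Set X}
    (hs : MeasurableSet[C] s) : @MemL2 X C mX μ (s.indicator 1) := by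
  refine ⟨memLp_indicator_const 2 (hC s hs) (1 : ℝ) (Or.inr (measure_ne_top _ _)), ?_⟩
  exact StronglyMeasurable.aestronglyMeasurable
    ((@stronglyMeasurable_one X ℝ C _ _).indicator hs)

theorem invariantPair_completion_stage (n : ℕ) :
    InvariantPair (completion (MeasurableSpace.comap (idmStage μ W n) inferInstance) μ)
      (completion (MeasurableSpace.comap (idmStage μ W (n + 1)) inferInstance) μ) μ W := by
  intro f hf
  obtain ⟨h, hh, hfh⟩ := exists_ae_eq_comp_of_completion hf.2
  let κ : ProbabilityTheory.Kernel (M n × SubProb (M n)) (M n) :=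
    ⟨fun a => a.2.1, (measurable_subProb_val (M n)).comp measurable_snd⟩
  -- Integrating `h` against the last coordinate is a measurable function on `M (n + 1)`, and T_W f
  -- is its pull-back along i_{W,n+1}.
  let G : M (n + 1) → ℝ := fun a => ∫ b, h b ∂κ a
  have hG : Measurable G := (hh.stronglyMeasurable.integral_kernel (κ := κ)).measurable
  have hfG : intOp μ W f = G ∘ idmStage μ W (n + 1) := by
    rw [intOp_congr μ W hfh]
    funext x
    exact intOp_comp μ W (measurable_idmStage μ W n) hh x
  have hm := measurable_idmStage μ W (n + 1)
  refine ⟨MemLp.of_bound (hfG ▸ (hG.comp hm).aestronglyMeasurable) _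
    (Filter.Eventually.of_forall (abs_intOp_le μ W (hf.1.integrable (by norm_num)))), ?_⟩
  rw [hfG]
  have : Measurable[MeasurableSpace.comap (idmStage μ W (n + 1)) inferInstance]
      (G ∘ idmStage μ W (n + 1)) := hG.comp (comap_measurable _)
  exact (this.mono (le_completion hm.comap_le μ) le_rfl).stronglyMeasurable.aestronglyMeasurable

end

theorem measurable_idmStage_zero {X : Type u} (D : MeasurableSpace X) [MeasurableSpace X]
    (μ : Measure X) [IsProbabilityMeasure μ] (W : IntegralKernel X) :
    Measurable[D] (idmStage μ W 0) :=
  @measurable_const _ _ _ D ()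

/-- The new coordinate is measurable once its evaluations are. These are T_W of indicators of
C-sets, hence in L²(D), and relative completeness makes them D-measurable outright. The old
coordinates are covered by C ≤ D. -/
theorem measurable_idmStage_succ {X : Type u} {C D : MeasurableSpace X} [mX : MeasurableSpace X]
    (μ : Measure X) [IsProbabilityMeasure μ] (W : IntegralKernel X) {n : ℕ}
    (hC : C ≤ mX) (hCD : C ≤ D)
    (hn : MeasurableSpace.comap (idmStage μ W n) inferInstance ≤ C)
    (hD : @RelComplete X D mX μ) (hCD' : @InvariantPair X C D mX μ W) :
    Measurable[D] (idmStage μ W (n + 1)) := by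
  have hi := @measurable_idmStage X mX μ _ W n
  have h1 : Measurable[D] (idmStage μ W n) := measurable_iff_comap_le.2 (hn.trans hCD)
  have hT : ∀ A, MeasurableSet A →
      Measurable[mX] (@intOp X mX μ W ((idmStage μ W n ⁻¹' A).indicator 1)) := fun A hA => by
    refine StronglyMeasurable.measurable (StronglyMeasurable.integral_prod_right'
      (f := fun p : X × X => W p * (idmStage μ W n ⁻¹' A).indicator 1 p.2) ?_)
    exact (W.measurable_toFun.mul
      ((measurable_one.indicator (hi hA)).comp measurable_snd)).stronglyMeasurable
  have h2 : Measurable[D] (@weightedPush X mX μ _ W _ _ (@idmStage X mX μ _ W n)) := by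
    refine @Measurable.subtype_mk _ _ D _ _ _ ?_ _
    refine @Measure.measurable_of_measurable_coe _ _ _ D _ fun A hA => ?_
    have hA' : MeasurableSet[C] (@idmStage X mX μ _ W n ⁻¹' A) := hn _ ⟨A, hA, rfl⟩
    have := @Measurable.ennreal_ofReal _ D _
      (@RelComplete.measurable X D mX μ hD _ (hT A hA)
        (hCD' _ (@memL2_indicator X mX μ _ C hC _ hA')).2)
    convert this using 2 with x
    exact @weightedPush_apply_eq_intOp X mX μ W _ _ _ _ hi x A hA
  exact @Measurable.prodMk _ D _ _ _ _ _ _ h1 h2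

section

variable {X : Type u} [mX : MeasurableSpace X] (μ : Measure X) [IsProbabilityMeasure μ]
  (W : IntegralKernel X)

theorem canonicalSeq_eq (n : ℕ) : canonicalSeq μ W n =
    completion (MeasurableSpace.comap (idmStage μ W n) inferInstance) μ := by
  have hle := fun m D hD h => completion_le (m := m) (D := D) (μ := μ) hD h
  induction n with
  | zero =>
    have h0 := fun D => measurable_idmStage_zero D μ W
    exact le_antisymm (canonicalSeq_zero_le μ W (relComplete_completion _ μ))
      (le_sInf fun D hD => hle _ D hD.1 (h0 D).comap_le)
  | succ n ih =>
    have hn : MeasurableSpace.comap (idmStage μ W n) inferInstance ≤ canonicalSeq μ W n := by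
      rw [ih]
      exact le_completion (measurable_idmStage μ W n).comap_le μ
    have hC : canonicalSeq μ W n ≤ mX := by
      rw [ih]
      exact (relComplete_completion _ μ).1
    have hsucc := canonicalSeq_le_succ μ W n
    have hstep := fun D h1 h2 h3 =>
      measurable_idmStage_succ μ W (n := n) (C := canonicalSeq μ W n) (D := D) hC h1 hn h2 h3
    -- The completion for stage n+1 is one of the competitors D. Conversely every competitor
    -- contains C_{n+1}, hence C_n, and so makes stage n+1 measurable.
    refine le_antisymm (sInf_le ⟨relComplete_completion _ μ, ?_⟩)
      (le_sInf fun D hD => hle _ D hD.1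
        (hstep D (hsucc.trans (sInf_le hD)) hD.1 hD.2).comap_le)
    rw [ih]
    exact invariantPair_completion_stage μ W n

theorem proj_comp_idm (n : ℕ) : IDM.proj n ∘ idm μ W = idmStage μ W n := by
  induction n with
  | zero => rfl
  | succ n ih =>
    funext x
    change M.snoc ((IDM.proj n ∘ idm μ W) x) _ = _
    rw [ih]
    rfl

theorem comap_idm_eq_iSup : MeasurableSpace.comap (idm μ W) inferInstance =
    ⨆ n, MeasurableSpace.comap (idmStage μ W n) inferInstance := by
  rw [← IDM.iSup_comap_proj, MeasurableSpace.comap_iSup]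
  refine iSup_congr fun n => ?_
  rw [MeasurableSpace.comap_comp, proj_comp_idm]

/-- `C(W)` consists of the measurable sets which agree almost everywhere with a preimage under the
map to iterated degree measures. -/
theorem minAlgebra_eq :
    minAlgebra μ W = completion (MeasurableSpace.comap (idm μ W) inferInstance) μ := by
  have hle := fun m D hD h => completion_le (m := m) (D := D) (μ := μ) hD h
  have hn : ∀ n, MeasurableSpace.comap (idmStage μ W n) inferInstance ≤ canonicalSeq μ W n :=
    fun n => by
      rw [canonicalSeq_eq]
      exact le_completion (measurable_idmStage μ W n).comap_le μ
  refine le_antisymm (sInf_le ⟨relComplete_completion _ μ, fun A hA => ?_⟩)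
    (le_sInf fun D hD => hle _ D hD.1 ?_)
  · obtain ⟨n, hA⟩ := mem_iUnion.1 hA
    rw [mem_ofPred_eq, canonicalSeq_eq] at hA
    refine completion_mono ?_ μ A hA
    rw [comap_idm_eq_iSup]
    exact le_iSup (fun n => MeasurableSpace.comap (idmStage μ W n) inferInstance) n
  · rw [@comap_idm_eq_iSup X mX μ]
    exact iSup_le fun n A hA => hD.2 A (mem_iUnion.2 ⟨n, hn n A hA⟩)

end

/-! ### The joint law and its density -/

theorem withDensity_prod_apply {X Y : Type*} [MeasurableSpace X] [MeasurableSpace Y]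
    (ρ : Measure X) (σ : Measure Y) [SFinite ρ] [SFinite σ] {f : X × Y → ℝ≥0∞} (hf : Measurable f)
    {s : Set X} {t : Set Y} (hs : MeasurableSet s) (ht : MeasurableSet t) :
    (ρ.prod σ).withDensity f (s ×ˢ t) = ∫⁻ x in s, ∫⁻ y in t, f (x, y) ∂σ ∂ρ := by
  rw [withDensity_apply _ (hs.prod ht), ← Measure.prod_restrict, lintegral_prod _ hf.aemeasurable]

theorem withDensity_le_self {X : Type*} [MeasurableSpace X] (ρ : Measure X) {f : X → ℝ≥0∞}
    (hf : ∀ x, f x ≤ 1) : ρ.withDensity f ≤ ρ := by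
  conv_rhs => rw [← withDensity_one (μ := ρ)]
  exact withDensity_mono (Filter.Eventually.of_forall hf)

section

variable {X : Type u} [MeasurableSpace X] (μ : Measure X) [IsProbabilityMeasure μ]
  (W : IntegralKernel X)

instance : IsProbabilityMeasure (kernelDIDM μ W) :=
  Measure.isProbabilityMeasure_map (measurable_idm μ W).aemeasurable

theorem measurePreserving_idm : MeasurePreserving (idm μ W) μ (kernelDIDM μ W) :=
  (measurable_idm μ W).measurePreserving μ

theorem IntegralKernel.measurable_ofReal : Measurable fun p => ENNReal.ofReal (W p) :=
  W.measurable_toFun.ennreal_ofReal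

/-- The image of the measure with density `W` on pairs of iterated degree measures. -/
def jointLaw : Measure (IDM × IDM) :=
  ((μ.prod μ).withDensity fun p => ENNReal.ofReal (W p)).map (Prod.map (idm μ W) (idm μ W))

theorem jointLaw_le : jointLaw μ W ≤ (kernelDIDM μ W).prod (kernelDIDM μ W) := by
  have hi := measurable_idm μ W
  rw [kernelDIDM, Measure.map_prod_map _ _ hi hi]
  exact Measure.map_mono (withDensity_le_self _ fun p => ENNReal.ofReal_le_one.2 (W.mem_Icc p).2)
    (hi.prodMap hi)

/-- `D` is a density of the joint law with values in `[0,1]`. -/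
structure IsJointDensity (D : IDM × IDM → ℝ≥0∞) : Prop where
  measurable : Measurable D
  le_one : ∀ p, D p ≤ 1
  withDensity_eq : ((kernelDIDM μ W).prod (kernelDIDM μ W)).withDensity D = jointLaw μ W

theorem exists_isJointDensity : ∃ D, IsJointDensity μ W D := by
  have hle := jointLaw_le μ W
  have : IsFiniteMeasure (jointLaw μ W) := isFiniteMeasure_of_le _ hle
  -- Truncating at 1 turns the almost everywhere bound into one valid at every point, so every
  -- section is a density below 1.
  refine ⟨fun p => min ((jointLaw μ W).rnDeriv ((kernelDIDM μ W).prod (kernelDIDM μ W)) p) 1,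
    (Measure.measurable_rnDeriv _ _).min measurable_const, fun p => min_le_right _ _, ?_⟩
  conv_rhs => rw [← Measure.withDensity_rnDeriv_eq _ _ (Measure.absolutelyContinuous_of_le hle)]
  refine withDensity_congr_ae ?_
  filter_upwards [Measure.rnDeriv_le_one_of_le hle] with p hp
  exact min_eq_left hp

theorem coord_idm_apply (x : X) (n : ℕ) {A : Set (M n)} (hA : MeasurableSet A) :
    (idm μ W x).coord n A =
      ∫⁻ y in idm μ W ⁻¹' (IDM.proj n ⁻¹' A), ENNReal.ofReal (W (x, y)) ∂μ := by
  rw [← preimage_comp, proj_comp_idm]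
  exact weightedPush_apply μ W (measurable_idmStage μ W n) x hA

theorem map_proj_map_idm (x : X) (n : ℕ) :
    ((μ.withDensity fun y => ENNReal.ofReal (W (x, y))).map (idm μ W)).map (IDM.proj n) =
      (idm μ W x).coord n := by
  rw [Measure.map_map (IDM.measurable_proj n) (measurable_idm μ W), proj_comp_idm]
  rfl

/-- Fubini: the inner integral of W(x,-) over the preimage of `A` is the coordinate of i_W(x)
evaluated at `A`. Thus the coordinates disintegrate the joint law. -/
theorem jointLaw_prod {B : Set IDM} (hB : MeasurableSet B) (n : ℕ) {A : Set (M n)}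
    (hA : MeasurableSet A) :
    jointLaw μ W (B ×ˢ (IDM.proj n ⁻¹' A)) = ∫⁻ α in B, α.coord n A ∂(kernelDIDM μ W) := by
  have hi := measurable_idm μ W
  have hA' := IDM.measurable_proj n hA
  have hpre : Prod.map (idm μ W) (idm μ W) ⁻¹' (B ×ˢ (IDM.proj n ⁻¹' A)) =
      (idm μ W ⁻¹' B) ×ˢ (idm μ W ⁻¹' (IDM.proj n ⁻¹' A)) := rfl
  rw [jointLaw, Measure.map_apply (hi.prodMap hi) (hB.prod hA'), hpre,
    withDensity_prod_apply μ μ W.measurable_ofReal (hi hB) (hi hA'), kernelDIDM,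
    setLIntegral_map hB (f := fun α : IDM => α.coord n A)
      ((Measure.measurable_coe hA).comp (IDM.measurable_coord n)) hi]
  simp only [coord_idm_apply μ W _ n hA]

variable {μ W} {D : IDM × IDM → ℝ≥0∞}

theorem IsJointDensity.measurable_section (hD : IsJointDensity μ W D) (α : IDM) :
    Measurable fun β => D (α, β) :=
  hD.measurable.comp measurable_prodMk_left

theorem IsJointDensity.section_le (hD : IsJointDensity μ W D) (α : IDM) :
    (kernelDIDM μ W).withDensity (fun β => D (α, β)) ≤ kernelDIDM μ W :=
  withDensity_le_self _ fun β => hD.le_one (α, β)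

theorem IsJointDensity.isFiniteMeasure_section (hD : IsJointDensity μ W D) (α : IDM) :
    IsFiniteMeasure ((kernelDIDM μ W).withDensity fun β => D (α, β)) :=
  isFiniteMeasure_of_le _ (hD.section_le α)

/-- The sections of the joint density have the coordinates as projections. -/
theorem IsJointDensity.map_proj (hD : IsJointDensity μ W D) :
    ∀ᵐ α ∂(kernelDIDM μ W), ∀ n,
      ((kernelDIDM μ W).withDensity fun β => D (α, β)).map (IDM.proj n) = α.coord n := by
  have hset : ∀ n (A : Set (M n)), MeasurableSet A → ∀ᵐ α ∂(kernelDIDM μ W),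
      ((kernelDIDM μ W).withDensity fun β => D (α, β)).map (IDM.proj n) A = α.coord n A := by
    intro n A hA
    have hA' := IDM.measurable_proj n hA
    have h := fun α => (Measure.map_apply (IDM.measurable_proj n) hA).trans
      (withDensity_apply (μ := kernelDIDM μ W) (fun β => D (α, β)) hA')
    simp only [h]
    refine ae_eq_of_forall_setLIntegral_eq_of_sigmaFinite ?_
      ((Measure.measurable_coe hA).comp (IDM.measurable_coord n)) fun B hB _ => ?_
    · exact hD.measurable.lintegral_prod_right'
    · rw [← jointLaw_prod μ W hB n hA, ← hD.withDensity_eq,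
        withDensity_prod_apply _ _ hD.measurable hB hA']
  refine ae_all_iff.2 fun n => ?_
  -- The null set in `hset` depends on `A`; a countable π-system leaves a single null set for all
  -- `A`.
  obtain ⟨S, hc, hpi, huniv, hgen⟩ := exists_countable_piSystem (M n)
  have hall := (ae_ball_iff hc).2 fun A hA =>
    hset n A (hgen ▸ MeasurableSpace.measurableSet_generateFrom hA)
  filter_upwards [hall] with α hα
  have := hD.isFiniteMeasure_section α
  exact ext_of_generate_finite S hgen hpi hα (hα univ huniv)

theorem IsJointDensity.limitMeasure_eq (hD : IsJointDensity μ W D) :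
    ∀ᵐ α ∂(kernelDIDM μ W),
      limitMeasure α = (kernelDIDM μ W).withDensity fun β => D (α, β) := by
  filter_upwards [hD.map_proj] with α hα
  have := hD.isFiniteMeasure_section α
  exact IteratedDegree.limitMeasure_eq hα

/-- The measures have the same projections, namely the coordinates of i_W(x). Hence the image of
W(x,-)μ depends on x only through i_W(x). -/
theorem IsJointDensity.map_idm (hD : IsJointDensity μ W D) :
    ∀ᵐ x ∂μ, (μ.withDensity fun y => ENNReal.ofReal (W (x, y))).map (idm μ W) =
      (kernelDIDM μ W).withDensity fun β => D (idm μ W x, β) := by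
  filter_upwards [(measurePreserving_idm μ W).quasiMeasurePreserving.ae hD.map_proj] with x hx
  have := hD.isFiniteMeasure_section (idm μ W x)
  exact (IDM.measure_ext fun n => (hx n).trans (map_proj_map_idm μ W x n).symm).symm

theorem isDIDM_kernelDIDM : IsDIDM (kernelDIDM μ W) := by
  obtain ⟨D, hD⟩ := exists_isJointDensity μ W
  refine ⟨inferInstance, ?_, ?_⟩
  · have : coherent =ᵐ[kernelDIDM μ W] univ := by
      refine Filter.eventuallyEq_univ.2 ?_
      filter_upwards [hD.map_proj] with α hα n
      rw [← hα, ← hα, Measure.map_map M.measurable_init (IDM.measurable_proj _),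
        IDM.init_comp_proj]
    rw [measure_congr this, measure_univ]
  · filter_upwards [hD.limitMeasure_eq] with α hα
    rw [hα]
    exact ⟨withDensity_absolutelyContinuous _ _,
      Measure.rnDeriv_le_one_of_le (hD.section_le α)⟩

theorem IsJointDensity.pairMeasure_eq (hD : IsJointDensity μ W D) :
    pairMeasure (kernelDIDM μ W) =
      ((kernelDIDM μ W).prod (kernelDIDM μ W)).withDensity D := by
  have happ : ∀ (s : Set (IDM × IDM)) (_ : MeasurableSet s) (α : IDM),
      (((kernelDIDM μ W).withDensity fun β => D (α, β)).map (Prod.mk α)) s =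
        ∫⁻ β, s.indicator D (α, β) ∂(kernelDIDM μ W) := fun s hs α => by
    have hs' : MeasurableSet (Prod.mk α ⁻¹' s) := measurable_prodMk_left hs
    rw [Measure.map_apply measurable_prodMk_left hs, withDensity_apply _ hs',
      ← lintegral_indicator hs']
    rfl
  have hm : Measurable fun α =>
      ((kernelDIDM μ W).withDensity fun β => D (α, β)).map (Prod.mk α) := by
    refine Measure.measurable_of_measurable_coe _ fun s hs => ?_
    simp only [happ s hs]
    exact (hD.measurable.indicator hs).lintegral_prod_right'
  -- `limitMeasure` is defined by choice; its almost everywhere measurability, needed to evaluate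
  -- `bind`, comes from this measurable version.
  have hae : (fun α => (limitMeasure α).map (Prod.mk α)) =ᵐ[kernelDIDM μ W]
      fun α => ((kernelDIDM μ W).withDensity fun β => D (α, β)).map (Prod.mk α) := by
    filter_upwards [hD.limitMeasure_eq] with α hα
    rw [hα]
  refine Measure.ext fun s hs => ?_
  rw [pairMeasure, Measure.bind_apply hs (hm.aemeasurable.congr hae.symm),
    withDensity_apply _ hs, ← lintegral_indicator hs,
    lintegral_prod _ (hD.measurable.indicator hs).aemeasurable]
  refine lintegral_congr_ae ?_
  filter_upwards [hae] with α hα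
  rw [hα, happ s hs]

theorem IsJointDensity.didmKernel_eq (hD : IsJointDensity μ W D) :
    ∀ᵐ p ∂((kernelDIDM μ W).prod (kernelDIDM μ W)),
      didmKernel (kernelDIDM μ W) p = (D p).toReal := by
  have h := Measure.rnDeriv_withDensity ((kernelDIDM μ W).prod (kernelDIDM μ W)) hD.measurable
  rw [← hD.pairMeasure_eq] at h
  filter_upwards [h] with p hp
  rw [didmKernel, hp]

theorem measurable_didmKernel (ν : Measure IDM) : Measurable (didmKernel ν) :=
  (Measure.measurable_rnDeriv _ _).ennreal_toReal

theorem measurePreserving_prodMap_idm :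
    MeasurePreserving (Prod.map (idm μ W) (idm μ W)) (μ.prod μ)
      ((kernelDIDM μ W).prod (kernelDIDM μ W)) :=
  (measurePreserving_idm μ W).prod (measurePreserving_idm μ W)

/-! ### Conditioning on C(W), and symmetry -/

theorem minAlgebra_le : minAlgebra μ W ≤ ‹MeasurableSpace X› :=
  minAlgebra_eq μ W ▸ (relComplete_completion _ μ).1

theorem comap_idm_le_minAlgebra :
    MeasurableSpace.comap (idm μ W) inferInstance ≤ minAlgebra μ W :=
  minAlgebra_eq μ W ▸ le_completion (measurable_idm μ W).comap_le μ

/-- Modulo a null set C is a preimage i_W⁻¹(A), and then the inner integrals agree for almost every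
x by `IsJointDensity.map_idm`; B is arbitrary. -/
theorem IsJointDensity.setLIntegral_eq (hD : IsJointDensity μ W D) {B C : Set X}
    (hB : MeasurableSet B) (hC : MeasurableSet[minAlgebra μ W] C) :
    (μ.prod μ).withDensity (fun p => ENNReal.ofReal (W p)) (B ×ˢ C) =
      (μ.prod μ).withDensity (D ∘ Prod.map (idm μ W) (idm μ W)) (B ×ˢ C) := by
  have hi := measurable_idm μ W
  have hC' : MeasurableSet C := minAlgebra_le C hC
  rw [withDensity_prod_apply μ μ W.measurable_ofReal hB hC',
    withDensity_prod_apply μ μ (hD.measurable.comp (hi.prodMap hi)) hB hC']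
  rw [minAlgebra_eq] at hC
  obtain ⟨⟨_, ⟨A, hA, rfl⟩, hCA⟩, -⟩ := measurableSet_completion.1 hC
  refine lintegral_congr_ae (ae_restrict_of_ae ?_)
  filter_upwards [hD.map_idm] with x hx
  rw [setLIntegral_congr hCA, setLIntegral_congr hCA, ← withDensity_apply _ (hi hA),
    ← Measure.map_apply hi hA, hx, withDensity_apply _ hA, kernelDIDM,
    setLIntegral_map hA (hD.measurable_section _) hi]
  rfl

/-- `W` averaged over `B × C(W)` is the pull-back of the joint density. -/
theorem IsJointDensity.condKernel_eq (hD : IsJointDensity μ W D) :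
    ∀ᵐ p ∂(μ.prod μ), condKernel (minAlgebra μ W) μ W p =
      (D (idm μ W p.1, idm μ W p.2)).toReal := by
  have hi := measurable_idm μ W
  have hDi : Measurable (D ∘ Prod.map (idm μ W) (idm μ W)) :=
    hD.measurable.comp (hi.prodMap hi)
  have hle : MeasurableSpace.prod ‹MeasurableSpace X› (minAlgebra μ W) ≤
      (inferInstance : MeasurableSpace (X × X)) :=
    sup_le_sup le_rfl (MeasurableSpace.comap_mono minAlgebra_le)
  have hfin1 : IsFiniteMeasure ((μ.prod μ).withDensity fun p => ENNReal.ofReal (W p)) :=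
    isFiniteMeasure_of_le _
      (withDensity_le_self _ fun p => ENNReal.ofReal_le_one.2 (W.mem_Icc p).2)
  have heq : ∀ s, MeasurableSet[MeasurableSpace.prod ‹MeasurableSpace X› (minAlgebra μ W)] s →
      ∫⁻ p in s, ENNReal.ofReal (W p) ∂(μ.prod μ) =
        ∫⁻ p in s, D (idm μ W p.1, idm μ W p.2) ∂(μ.prod μ) := fun s hs => by
    -- Rectangles B × C form a π-system generating the conditioning algebra, so agreement on them
    -- suffices.
    have h := ext_on_measurableSpace_of_generate_finite (inferInstance : MeasurableSpace (X × X))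
      (μ := (μ.prod μ).withDensity fun p => ENNReal.ofReal (W p))
      (ν := (μ.prod μ).withDensity (D ∘ Prod.map (idm μ W) (idm μ W))) _
      ?_ hle (@generateFrom_prod X X _ (minAlgebra μ W)).symm
      (@isPiSystem_prod X X _ (minAlgebra μ W)) ?_ hs
    · rwa [withDensity_apply _ (hle s hs), withDensity_apply _ (hle s hs)] at h
    · rintro _ ⟨B, hB, C, hC, rfl⟩
      exact hD.setLIntegral_eq hB hC
    · rw [← univ_prod_univ]
      exact hD.setLIntegral_eq MeasurableSet.univ (@MeasurableSet.univ X (minAlgebra μ W))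
  have hWint : Integrable W.toFun (μ.prod μ) :=
    Integrable.of_bound W.measurable_toFun.aestronglyMeasurable 1
      (Filter.Eventually.of_forall fun p => by
        rw [Real.norm_eq_abs, abs_of_nonneg (W.mem_Icc p).1]
        exact (W.mem_Icc p).2)
  have hDint : Integrable (fun p : X × X => (D (idm μ W p.1, idm μ W p.2)).toReal) (μ.prod μ) :=
    Integrable.of_bound hDi.ennreal_toReal.aestronglyMeasurable 1
      (Filter.Eventually.of_forall fun p => by
        rw [Real.norm_eq_abs, abs_of_nonneg ENNReal.toReal_nonneg]
        exact ENNReal.toReal_le_of_le_ofReal zero_le_one (by simpa using hD.le_one _))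
  refine (ae_eq_condExp_of_forall_setIntegral_eq hle hWint (fun s _ _ => hDint.integrableOn)
    (fun s hs _ => ?_) ?_).symm
  · rw [integral_eq_lintegral_of_nonneg_ae
        (Filter.Eventually.of_forall fun p => (W.mem_Icc p).1)
        W.measurable_toFun.aestronglyMeasurable,
      heq s hs]
    exact integral_toReal hDi.aemeasurable
      (Filter.Eventually.of_forall fun p => (hD.le_one _).trans_lt ENNReal.one_lt_top)
  · have hC : Measurable[minAlgebra μ W] (idm μ W) :=
      measurable_iff_comap_le.2 comap_idm_le_minAlgebra
    have h1 : Measurable[MeasurableSpace.prod ‹MeasurableSpace X› (minAlgebra μ W)]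
        fun p : X × X => idm μ W p.1 := hi.comp (@measurable_fst X X _ (minAlgebra μ W))
    have h2 : Measurable[MeasurableSpace.prod ‹MeasurableSpace X› (minAlgebra μ W)]
        fun p : X × X => idm μ W p.2 := hC.comp (@measurable_snd X X _ (minAlgebra μ W))
    exact (hD.measurable.comp (@Measurable.prodMk _ (_) _ _ _ _ _ _ h1 h2)).ennreal_toReal
      |>.stronglyMeasurable.aestronglyMeasurable

/-- Symmetry of W makes the joint law invariant under the swap, and densities are unique almost
everywhere. -/
theorem isGraphon_didmKernel (hW : IsGraphon μ W) :
    IsGraphon (kernelDIDM μ W) (didmKernel (kernelDIDM μ W)) := by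
  obtain ⟨D, hD⟩ := exists_isJointDensity μ W
  refine ⟨measurable_didmKernel _, ?_, ?_⟩
  · filter_upwards [hD.didmKernel_eq] with p hp
    rw [hp]
    exact ⟨ENNReal.toReal_nonneg, ENNReal.toReal_le_of_le_ofReal zero_le_one (by
      simpa using hD.le_one p)⟩
  · have hswap : (jointLaw μ W).map Prod.swap = jointLaw μ W := by
      have hi := (measurable_idm μ W).prodMap (measurable_idm μ W)
      refine Measure.ext fun s hs => ?_
      rw [Measure.map_apply measurable_swap hs, jointLaw,
        Measure.map_apply hi (measurable_swap hs), Measure.map_apply hi hs,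
        withDensity_apply _ (hi (measurable_swap hs)), withDensity_apply _ (hi hs)]
      rw [← (Measure.measurePreserving_swap (μ := μ) (ν := μ)).setLIntegral_comp_preimage
        (hi hs) W.measurable_ofReal]
      refine lintegral_congr_ae (ae_restrict_of_ae ?_)
      filter_upwards [hW.symm] with p hp
      exact congrArg ENNReal.ofReal hp
    have hmp : MeasurePreserving (Prod.swap : IDM × IDM → IDM × IDM)
        ((kernelDIDM μ W).prod (kernelDIDM μ W)) ((kernelDIDM μ W).prod (kernelDIDM μ W)) :=
      Measure.measurePreserving_swap
    have hDD : D =ᵐ[(kernelDIDM μ W).prod (kernelDIDM μ W)] D ∘ Prod.swap := by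
      refine ae_eq_of_forall_setLIntegral_eq_of_sigmaFinite hD.measurable
        (hD.measurable.comp measurable_swap) fun s hs _ => ?_
      have hs' : MeasurableSet (Prod.swap ⁻¹' s : Set (IDM × IDM)) := measurable_swap hs
      have h2 := hmp.setLIntegral_comp_preimage hs' hD.measurable
      rw [← preimage_comp, Prod.swap_swap_eq, preimage_id] at h2
      rw [← withDensity_apply _ hs, hD.withDensity_eq, ← hswap,
        Measure.map_apply measurable_swap hs, ← hD.withDensity_eq, withDensity_apply _ hs', ← h2]
      rfl
    filter_upwards [hD.didmKernel_eq, hmp.quasiMeasurePreserving.ae hD.didmKernel_eq, hDD]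
      with p h1 h2 h3
    change didmKernel _ p = didmKernel _ p.swap
    rw [h1, h2, h3]
    rfl

end

/-! ### Quotients -/

theorem isQuotient_of_eq_completion {X : Type u} {C mX : MeasurableSpace X} {Y : Type v}
    [mY : MeasurableSpace Y] {μ : Measure X} {q : X → Y} (hq : Measurable[mX] q)
    (hC : C = completion (MeasurableSpace.comap q mY) μ) : IsQuotient C μ q := by
  subst hC
  have hqmp := hq.measurePreserving μ
  refine ⟨hq, Submodule.ext fun f => ?_⟩
  rw [mem_lpMeas_iff_aestronglyMeasurable, LinearMap.mem_range]
  constructor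
  · rintro ⟨g, rfl⟩
    have hg : Measurable[MeasurableSpace.comap q mY] (g ∘ q) :=
      (Lp.stronglyMeasurable g).measurable.comp (comap_measurable q)
    exact ⟨g ∘ q, (hg.mono (le_completion hq.comap_le μ) le_rfl).stronglyMeasurable,
      Lp.coeFn_compMeasurePreserving g hqmp⟩
  · intro hf
    obtain ⟨k, hk, hfk⟩ := exists_ae_eq_comp_of_completion hf
    have hk2 : MemLp k 2 (μ.map q) :=
      (memLp_map_measure_iff hk.aestronglyMeasurable hq.aemeasurable).2
        ((memLp_congr_ae hfk).1 (Lp.memLp f))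
    refine ⟨hk2.toLp k, Lp.ext ?_⟩
    refine (Lp.coeFn_compMeasurePreserving _ hqmp).trans ?_
    exact (hqmp.quasiMeasurePreserving.ae_eq_comp hk2.coeFn_toLp).trans hfk.symm

theorem IsQuotient.exists_preimage_ae_eq {X : Type u} {C mX : MeasurableSpace X} {Y : Type v}
    [MeasurableSpace Y] {μ : Measure X} [IsFiniteMeasure μ] {q : X → Y} (h : IsQuotient C μ q)
    (hC : C ≤ mX) {s : Set X} (hs : MeasurableSet[C] s) :
    ∃ T, MeasurableSet T ∧ s =ᵐ[μ] q ⁻¹' T := by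
  have hL : MemLp (s.indicator fun _ => (1 : ℝ)) 2 μ :=
    memLp_indicator_const 2 (hC s hs) 1 (Or.inr (measure_ne_top _ _))
  have hmem : hL.toLp _ ∈ lpMeas ℝ ℝ C 2 μ := by
    rw [mem_lpMeas_iff_aestronglyMeasurable]
    exact ⟨_, (@stronglyMeasurable_const X ℝ C _ 1).indicator hs, hL.coeFn_toLp⟩
  rw [← h.range_eq] at hmem
  obtain ⟨g, hg⟩ := hmem
  -- `g` represents the indicator of `s` on the quotient, so its level set at 1 pulls back to `s`
  -- modulo a null set.
  refine ⟨g ⁻¹' {1}, (Lp.stronglyMeasurable g).measurable (measurableSet_singleton 1), ?_⟩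
  have h1 := Lp.coeFn_compMeasurePreserving g (h.measurable.measurePreserving μ)
  have h2 : Lp.compMeasurePreserving q (h.measurable.measurePreserving μ) g = hL.toLp _ := hg
  rw [h2] at h1
  have h3 := h1.symm.trans hL.coeFn_toLp
  have h4 := h3.preimage {1}
  refine Filter.EventuallyEq.trans (Filter.Eventually.of_forall fun x => ?_) h4.symm
  refine propext ?_
  change x ∈ s ↔ s.indicator (fun _ => (1 : ℝ)) x = 1
  by_cases hx : x ∈ s <;> simp [hx]

theorem IsQuotient.measurableSet_preimage {X : Type u} {C mX : MeasurableSpace X} {Y : Type v}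
    [MeasurableSpace Y] {μ : Measure X} [IsFiniteMeasure μ] {q : X → Y} (h : IsQuotient C μ q)
    (hC : RelComplete C μ) {T : Set Y} (hT : MeasurableSet T) : MeasurableSet[C] (q ⁻¹' T) := by
  have hL : MemLp (T.indicator fun _ => (1 : ℝ)) 2 (μ.map q) :=
    memLp_indicator_const 2 hT 1 (Or.inr (measure_ne_top _ _))
  have hqmp := h.measurable.measurePreserving μ
  have hmem : pullback hqmp (hL.toLp _) ∈ lpMeas ℝ ℝ C 2 μ := by
    rw [← h.range_eq]
    exact ⟨_, rfl⟩
  rw [mem_lpMeas_iff_aestronglyMeasurable] at hmem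
  obtain ⟨g, hg, hgT⟩ := hmem
  have h1 : (T.indicator fun _ => (1 : ℝ)) ∘ q =ᵐ[μ] g :=
    ((Lp.coeFn_compMeasurePreserving _ hqmp).trans
      (hqmp.quasiMeasurePreserving.ae_eq_comp hL.coeFn_toLp)).symm.trans hgT
  refine hC.2 _ _ (h.measurable hT) (hg.measurable (measurableSet_singleton 1))
    (measure_symmDiff_eq_zero_iff.2 ?_)
  refine Filter.EventuallyEq.trans (Filter.Eventually.of_forall fun x => ?_) (h1.preimage {1})
  refine propext ?_
  change q x ∈ T ↔ T.indicator (fun _ => (1 : ℝ)) (q x) = 1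
  by_cases hx : q x ∈ T <;> simp [hx]

/-- Lets Cantor space, which is standard Borel, replace `IDM` as the target of a quotient map. -/
theorem comap_mapNatBool (K : Type*) [mK : MeasurableSpace K]
    [MeasurableSpace.CountablyGenerated K] :
    MeasurableSpace.comap (MeasurableSpace.mapNatBool K) inferInstance = mK := by
  refine le_antisymm (MeasurableSpace.measurable_mapNatBool K).comap_le ?_
  conv_lhs => rw [← MeasurableSpace.generateFrom_natGeneratingSequence K]
  refine MeasurableSpace.generateFrom_le ?_
  rintro _ ⟨n, rfl⟩
  refine ⟨(fun b : ℕ → Bool => b n) ⁻¹' {true}, measurable_pi_apply n (measurableSet_singleton true), ?_⟩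
  ext x
  simp [MeasurableSpace.mapNatBool]

theorem adjoint_pullback_apply {X : Type u} {Y : Type v} [MeasurableSpace X]
    [MeasurableSpace Y] {μ : Measure X} {ν : Measure Y} {q : X → Y}
    (hq : MeasurePreserving q μ ν) (F : Lp ℝ 2 ν) :
    ContinuousLinearMap.adjoint (pullback hq).toContinuousLinearMap (pullback hq F) = F := by
  refine ext_inner_right ℝ fun G => ?_
  rw [ContinuousLinearMap.adjoint_inner_left]
  exact (pullback hq).inner_map_map F G

/-! ### The quotient by C(W) and the isomorphism -/

section

variable {X : Type u} [MeasurableSpace X] {μ : Measure X} [IsProbabilityMeasure μ]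
  {W : IntegralKernel X}

theorem exists_isQuotient_minAlgebra (μ : Measure X) [IsProbabilityMeasure μ]
    (W : IntegralKernel X) :
    ∃ q : X → ℕ → Bool, IsQuotient (minAlgebra μ W) μ q := by
  refine ⟨MeasurableSpace.mapNatBool IDM ∘ idm μ W, isQuotient_of_eq_completion
    ((MeasurableSpace.measurable_mapNatBool IDM).comp (measurable_idm μ W)) ?_⟩
  rw [minAlgebra_eq, ← MeasurableSpace.comap_comp, comap_mapNatBool]

/-- If preimages under `i_W` agree almost everywhere with preimages under `q`, then `i_W` factors
through `q` almost everywhere. -/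
theorem exists_idm_ae_eq_comp {Y : Type v} [MeasurableSpace Y] {q : X → Y}
    (h : ∀ S, MeasurableSet S → ∃ T, MeasurableSet T ∧ idm μ W ⁻¹' S =ᵐ[μ] q ⁻¹' T) :
    ∃ j : Y → IDM, Measurable j ∧ idm μ W =ᵐ[μ] j ∘ q := by
  obtain ⟨D, hD⟩ := exists_isJointDensity μ W
  -- The factorization lemma is applied to D(i_W(x),β), whose values lie in a standard Borel space.
  -- The point i_W(x) is then recovered as the sequence of projections of D(i_W(x),-)ν; truncating
  -- `k` at 1 keeps masses at most 1 for every y.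
  obtain ⟨k, hk, hDk⟩ := exists_ae_eq_comp (μ := μ.prod (kernelDIDM μ W))
    (i := Prod.map q (id : IDM → IDM)) (f := D ∘ Prod.map (idm μ W) (id : IDM → IDM))
    fun B hB => exists_preimage_prodMap_ae_eq h (hD.measurable hB)
  let m : Y → Measure IDM := fun y => (kernelDIDM μ W).withDensity fun β => min (k (y, β)) 1
  have hm : ∀ y n, (m y).map (IDM.proj n) univ ≤ 1 := fun y n =>
    (map_mass_le _ _).trans
      ((withDensity_le_self _ (fun β => min_le_right _ _) univ).trans measure_univ.le)
  have hmm : Measurable m := by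
    refine Measure.measurable_of_measurable_coe _ fun s hs => ?_
    simp only [m, withDensity_apply _ hs]
    exact (hk.min measurable_const).lintegral_prod_right'
  let j : Y → IDM := fun y n =>
    match n with
    | 0 => ()
    | n + 1 => (⟨(m y).map (IDM.proj n), hm y n⟩ : SubProb (M n))
  have hj : Measurable j := by
    refine measurable_pi_lambda _ fun n => ?_
    cases n with
    | zero => exact measurable_const
    | succ n =>
      exact Measurable.subtype_mk ((Measure.measurable_map _ (IDM.measurable_proj n)).comp hmm)
  refine ⟨j, hj, ?_⟩
  filter_upwards [Measure.ae_ae_of_ae_prod hDk,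
    (measurePreserving_idm μ W).quasiMeasurePreserving.ae hD.map_proj] with x hx hx'
  have hmx : m (q x) = (kernelDIDM μ W).withDensity fun β => D (idm μ W x, β) := by
    refine withDensity_congr_ae ?_
    filter_upwards [hx] with β hβ
    have hβ' : D (idm μ W x, β) = k (q x, β) := hβ
    rw [← hβ']
    exact min_eq_left (hD.le_one _)
  funext n
  cases n with
  | zero => rfl
  | succ n =>
    refine Subtype.ext (Eq.symm ?_)
    change (m (q x)).map (IDM.proj n) = (idm μ W x).coord n
    rw [hmx, hx' n]

theorem measurableSet_eq_of_countablyGenerated {Y K : Type*} [MeasurableSpace Y]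
    [MeasurableSpace K] [MeasurableSpace.CountablyGenerated K] [MeasurableSpace.SeparatesPoints K]
    {f g : Y → K} (hf : Measurable f) (hg : Measurable g) : MeasurableSet {y | f y = g y} := by
  have hm := MeasurableSpace.measurable_mapNatBool K
  convert measurableSet_eq_fun (hm.comp hf) (hm.comp hg) using 3 with y
  exact (MeasurableSpace.injective_mapNatBool K).eq_iff.symm

/-- With i_W = j∘q and q = k∘i_W almost everywhere, j and k are inverse modulo null sets. Moreover
W_{C(W)} is the pull-back along q × q of F = D∘(j×j), and the adjoint of an isometry is a left
inverse of it, so W/C(W) = F. -/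
theorem isomorphic_quotientKernel {Y : Type v} [MeasurableSpace Y] [StandardBorelSpace Y]
    {q : X → Y} (hq : IsQuotient (minAlgebra μ W) μ q) :
    Isomorphic (μ.map q) (quotientKernel (minAlgebra μ W) μ W hq.measurable)
      (kernelDIDM μ W) (didmKernel (kernelDIDM μ W)) := by
  have : Nonempty X := nonempty_of_isProbabilityMeasure μ
  have : Nonempty Y := this.map q
  have hi := measurePreserving_idm μ W
  have hqmp := hq.measurable.measurePreserving μ
  have hrel : RelComplete (minAlgebra μ W) μ := minAlgebra_eq μ W ▸ relComplete_completion _ μ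
  obtain ⟨j, hj, hij⟩ := exists_idm_ae_eq_comp (μ := μ) (W := W) (q := q) fun S hS =>
    hq.exists_preimage_ae_eq hrel.1 (comap_idm_le_minAlgebra _ ⟨S, hS, rfl⟩)
  obtain ⟨k, hk, hqk⟩ := exists_ae_eq_comp (μ := μ) (i := idm μ W) (f := q) fun B hB => by
    have := hq.measurableSet_preimage hrel hB
    rw [minAlgebra_eq] at this
    obtain ⟨⟨_, ⟨A, hA, rfl⟩, h⟩, -⟩ := measurableSet_completion.1 this
    exact ⟨A, hA, h⟩
  have : IsProbabilityMeasure (μ.map q) :=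
    Measure.isProbabilityMeasure_map hq.measurable.aemeasurable
  refine ⟨j, k, ⟨hj, ?_⟩, ⟨hk, ?_⟩, ?_, ?_, ?_⟩
  · rw [Measure.map_map hj hq.measurable, ← Measure.map_congr hij]
    rfl
  · rw [kernelDIDM, Measure.map_map hk hi.measurable, ← Measure.map_congr hqk]
  -- Both inverse relations are tested at points q(x) and i_W(x), which suffices because the
  -- measures are push-forwards of μ.
  · refine (ae_map_iff (p := fun y => k (j y) = y) hq.measurable.aemeasurable
      (measurableSet_eq_fun (hk.comp hj) measurable_id)).2 ?_
    filter_upwards [hij, hqk] with x h1 h2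
    simp only [Function.comp_apply] at h1 h2
    rw [← h1, ← h2]
  · refine (ae_map_iff (p := fun α => j (k α) = α) hi.measurable.aemeasurable
      (measurableSet_eq_of_countablyGenerated (hj.comp hk) measurable_id)).2 ?_
    filter_upwards [hij, hqk] with x h1 h2
    simp only [Function.comp_apply] at h1 h2
    rw [← h2, ← h1]
  · obtain ⟨D, hD⟩ := exists_isJointDensity μ W
    have hqq := hqmp.prod hqmp
    have hjj : MeasurePreserving j (μ.map q) (kernelDIDM μ W) := ⟨hj, by
      rw [Measure.map_map hj hq.measurable, ← Measure.map_congr hij]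
      rfl⟩
    let F : Y × Y → ℝ := fun p => (D (j p.1, j p.2)).toReal
    have hF : Measurable F := (hD.measurable.comp (hj.prodMap hj)).ennreal_toReal
    have hF2 : MemLp F 2 ((μ.map q).prod (μ.map q)) :=
      MemLp.of_bound hF.aestronglyMeasurable 1 (Filter.Eventually.of_forall fun p => by
        rw [Real.norm_eq_abs, abs_of_nonneg ENNReal.toReal_nonneg]
        exact ENNReal.toReal_le_of_le_ofReal zero_le_one (by simpa using hD.le_one _))
    have hFW : (memLp_condKernel (minAlgebra μ W) μ W).toLp _ = pullback hqq (hF2.toLp F) := by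
      refine Lp.ext ?_
      refine (MemLp.coeFn_toLp _).trans (Filter.EventuallyEq.trans ?_
        ((Lp.coeFn_compMeasurePreserving _ hqq).trans
          (hqq.quasiMeasurePreserving.ae_eq_comp hF2.coeFn_toLp)).symm)
      filter_upwards [hD.condKernel_eq, Measure.quasiMeasurePreserving_fst.ae hij,
        Measure.quasiMeasurePreserving_snd.ae hij] with p h1 h2 h3
      rw [h1, h2, h3]
      rfl
    have hK : quotientKernel (minAlgebra μ W) μ W hq.measurable = hF2.toLp F := by
      rw [quotientKernel, hFW]
      exact adjoint_pullback_apply hqq _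
    rw [hK]
    filter_upwards [hF2.coeFn_toLp, (hjj.prod hjj).quasiMeasurePreserving.ae hD.didmKernel_eq]
      with p h1 h2
    rw [h1]
    exact h2.symm

end

end IteratedDegree

end

theorem theorem6p8 {X : Type u} [MeasurableSpace X] [StandardBorelSpace X]
    (μ : Measure X) [IsProbabilityMeasure μ] (W : IteratedDegree.IntegralKernel X) :
    IteratedDegree.IsDIDM (IteratedDegree.kernelDIDM μ W) ∧
    (∀ᵐ p ∂(μ.prod μ),
      IteratedDegree.condKernel (IteratedDegree.minAlgebra μ W) μ W p =
        IteratedDegree.didmKernel (IteratedDegree.kernelDIDM μ W)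
          (IteratedDegree.idm μ W p.1, IteratedDegree.idm μ W p.2)) ∧
    (IteratedDegree.IsGraphon μ W →
      (∃ (Y : Type) (_ : MeasurableSpace Y) (_ : StandardBorelSpace Y) (q : X → Y),
        IteratedDegree.IsQuotient (IteratedDegree.minAlgebra μ W) μ q) ∧
      (∀ (Y : Type v) [MeasurableSpace Y] [StandardBorelSpace Y] (q : X → Y)
        (hq : IteratedDegree.IsQuotient (IteratedDegree.minAlgebra μ W) μ q),
        IteratedDegree.Isomorphic (μ.map q)
          (IteratedDegree.quotientKernel (IteratedDegree.minAlgebra μ W) μ W hq.measurable)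
          (IteratedDegree.kernelDIDM μ W)
          (IteratedDegree.didmKernel (IteratedDegree.kernelDIDM μ W))) ∧
      IteratedDegree.IsGraphon (IteratedDegree.kernelDIDM μ W)
        (IteratedDegree.didmKernel (IteratedDegree.kernelDIDM μ W))) := by
  refine ⟨IteratedDegree.isDIDM_kernelDIDM, ?_, fun hW => ⟨?_, fun Y _ _ q hq =>
    IteratedDegree.isomorphic_quotientKernel hq, IteratedDegree.isGraphon_didmKernel hW⟩⟩
  · obtain ⟨D, hD⟩ := IteratedDegree.exists_isJointDensity μ W
    filter_upwards [hD.condKernel_eq,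
      IteratedDegree.measurePreserving_prodMap_idm.quasiMeasurePreserving.ae hD.didmKernel_eq]
      with p h1 h2
    rw [h1]
    exact h2.symm
  · obtain ⟨q, hq⟩ := IteratedDegree.exists_isQuotient_minAlgebra μ W
    exact ⟨ℕ → Bool, inferInstance, inferInstance, q, hq⟩
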